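/- For $n\ge 0$, a morphism $\{0,1\}^m\to\{0,1\}^n$ is a map that is the restriction of an affine homomorphism $\mathbb{Z}^m\to\mathbb{Z}^n$. A \emph{nilspace} is a set $X$ together with a set $C^n(X)\subseteq X^{\{0,1\}^n}$ of \emph{$n$-cubes} for each $n\ge 0$ such that: (i) if $\phi:\{0,1\}^m\to\{0,1\}^n$ is a morphism and $q\in C^n(X)$, then $q\circ\phi\in C^m(X)$; (ii) $C^1(X)=X^{\{0,1\}}$; (iii) for every $n\ge 1$, every \emph{$n$-corner}, i.e. every map $q':\{0,1\}^n\setminus\{1^n\}\to X$ whose restriction to each $(n-1)$-dimensional face containing $0^n$ is an $(n-1)$-cube, agrees on $\{0,1\}^n\setminus\{1^n\}$ with some $n$-cube, called a \emph{completion} of $q'$. The nilspace is \emph{$k$-step} if every $(k+1)$-corner has a unique completion, and \emph{$k$-fold ergodic} if $C^k(X)=X^{\{0,1\}^k}$. An isomorphism between sets with such families of cubes is a bijection that maps cubes to cubes in both directions. For an abelian group $Z$, the \emph{degree-$k$ structure} $\mathcal{D}_k(Z)$ is $Z$ with the following cubes: the $n$-cubes are the elements of the subgroup of $Z^{\{0,1\}^n}$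 generated by the maps equal to $g$ on $F$ and to $0$ off $F$, where $g\in Z$ and $F$ is a face of $\{0,1\}^n$ of codimension at most $k$. On a nilspace $X$, write $x\sim_j y$ if there are $q_0,q_1\in C^{j+1}(X)$ with $q_0(0^{j+1})=x$, $q_1(0^{j+1})=y$ and $q_0(v)=q_1(v)$ for all $v\ne 0^{j+1}$. Let $k\ge 0$ and let $X$ be a $k$-step nilspace. (1) If $X$ is non-empty and $k$-fold ergodic, then there is an abelian group $Z$ such that $X$ is isomorphic to $\mathcal{D}_k(Z)$. (2) If $k\ge 1$, then $\sim_{k-1}$ is an equivalence relation on $X$, and for each of its equivalence classes $F$ there is an abelian group $Z$ such that $F$, with the cubes $\{q\in C^n(X): q(\{0,1\}^n)\subseteq F\}$, $n\ge 0$, is isomorphic to $\mathcal{D}_k(Z)$. -/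

import Mathlib

universe u

namespace Nilspace

/-- The discrete `n`-cube `{0,1}^n`, with `false` in the role of `0` and `true` in the role
of `1`. -/
abbrev Cube (n : ℕ) : Type := Fin n → Bool

/-- The vertex `0^n`. -/
def vertexZero (n : ℕ) : Cube n := fun _ => false

/-- The vertex `1^n`. -/
def vertexOne (n : ℕ) : Cube n := fun _ => true

/-- The inclusion `{0,1}^n ⊆ ℤ^n`. -/
def Cube.toInt {n : ℕ} (v : Cube n) : Fin n → ℤ := fun i => (v i).toInt

/-- A discrete-cube morphism: a map `{0,1}^m → {0,1}^n` which is the restriction of an affine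
homomorphism `x ↦ f x + t` from `ℤ^m` to `ℤ^n`. -/
def IsCubeMorphism {m n : ℕ} (φ : Cube m → Cube n) : Prop :=
  ∃ (f : (Fin m → ℤ) →+ (Fin n → ℤ)) (t : Fin n → ℤ),
    ∀ v : Cube m, (φ v).toInt = f v.toInt + t

/-- A set of maps `{0,1}^n → X` (the `n`-cubes on `X`) for each `n ≥ 0`; no axioms yet. -/
abbrev CubeStructure (X : Type*) := (n : ℕ) → Set (Cube n → X)

variable {X Y : Type*}

/-- The structure is `k`-fold ergodic: every map `{0,1}^k → X` is a `k`-cube. -/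
def IsErgodic (C : CubeStructure X) (k : ℕ) : Prop := C k = Set.univ

/-- `q'` is an `(m+1)`-corner: its restriction to each `m`-face of `{0,1}^(m+1)` that contains
`0^(m+1)`, that is, to each face `{v | v i = 0}`, is an `m`-cube. Such a face is parametrized in
the order-preserving way, by inserting a `0` at the coordinate `i`. These faces do not contain
`1^(m+1)`, so the value of `q'` at `1^(m+1)` plays no role: `q'` stands for a map on
`{0,1}^(m+1) \ {1^(m+1)}`. -/
def IsCorner (C : CubeStructure X) {m : ℕ} (q' : Cube (m + 1) → X) : Prop :=
  ∀ i : Fin (m + 1), (fun v : Cube m => q' (i.insertNth (α := fun _ => Bool) false v)) ∈ C m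

/-- `q` is a cube that agrees with the corner `q'` at every vertex other than `1^(m+1)`. -/
def IsCompletion (C : CubeStructure X) {m : ℕ} (q' q : Cube (m + 1) → X) : Prop :=
  q ∈ C (m + 1) ∧ ∀ v : Cube (m + 1), v ≠ vertexOne (m + 1) → q v = q' v

/-- The axioms of a nilspace. -/
structure IsNilspace (C : CubeStructure X) : Prop where
  composition : ∀ {m n : ℕ} (φ : Cube m → Cube n), IsCubeMorphism φ →
    ∀ q ∈ C n, q ∘ φ ∈ C m
  ergodicity : IsErgodic C 1
  corner_completion : ∀ {m : ℕ} (q' : Cube (m + 1) → X), IsCorner C q' →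
    ∃ q, IsCompletion C q' q

/-- A `k`-step nilspace: a nilspace in which every `(k+1)`-corner has a unique completion. -/
structure IsStepNilspace (C : CubeStructure X) (k : ℕ) : Prop extends IsNilspace C where
  unique_completion : ∀ q' : Cube (k + 1) → X, IsCorner C q' → ∃! q, IsCompletion C q' q

/-- A morphism: a map that sends cubes to cubes. -/
def IsMorphism (C : CubeStructure X) (D : CubeStructure Y) (f : X → Y) : Prop :=
  ∀ (n : ℕ), ∀ q ∈ C n, f ∘ q ∈ D n

/-- Isomorphism: a bijection which is a morphism in both directions. -/
def Isomorphic (C : CubeStructure X) (D : CubeStructure Y) : Prop :=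
  ∃ e : X ≃ Y, IsMorphism C D e ∧ IsMorphism D C e.symm

/-- The cube structure on a subset `F` of `X`, restricted from `X`: the `F`-valued cubes. -/
def restrict (C : CubeStructure X) (F : Set X) : CubeStructure F :=
  fun n => {q | (fun v => (q v : X)) ∈ C n}

/-- The relation `x ∼_k y`. -/
def Sim (C : CubeStructure X) (k : ℕ) (x y : X) : Prop :=
  ∃ q₀ ∈ C (k + 1), ∃ q₁ ∈ C (k + 1),
    q₀ (vertexZero (k + 1)) = x ∧ q₁ (vertexZero (k + 1)) = y ∧
      ∀ v : Cube (k + 1), v ≠ vertexZero (k + 1) → q₀ v = q₁ v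

/-- The class of `x` under `∼_k`. -/
def simClass (C : CubeStructure X) (k : ℕ) (x : X) : Set X := {y | Sim C k x y}

/-- The face of `{0,1}^n` obtained by fixing the coordinates in `I` to be those of `x`;
its codimension is the cardinality of `I`. -/
def face {n : ℕ} (I : Finset (Fin n)) (x : Cube n) : Set (Cube n) := {v | ∀ i ∈ I, v i = x i}

/-- The group of `n`-cubes on an abelian group `Z` with a filtration `G`: the subgroup of
`Z^({0,1}^n)` generated by the maps equal to `g` on a face `F` and to `0` off `F`, for all faces
`F` and all `g` in `G (codim F)`. -/
def filteredCubes {Z : Type*} [AddCommGroup Z] (G : ℕ → AddSubgroup Z) (n : ℕ) :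
    AddSubgroup (Cube n → Z) :=
  AddSubgroup.closure
    {c | ∃ (I : Finset (Fin n)) (x : Cube n), ∃ g ∈ G I.card,
      c = (face I x).indicator (fun _ => g)}

/-- The maximal filtration of degree `k` on `Z`: `Z_0 = ⋯ = Z_k = Z` and `Z_i = 0` for `i > k`. -/
def maxFiltration (Z : Type*) [AddCommGroup Z] (k : ℕ) : ℕ → AddSubgroup Z :=
  fun i => if i ≤ k then ⊤ else ⊥

/-- The degree-`k` structure on the abelian group `Z`. -/
def degreeStructure (k : ℕ) (Z : Type*) [AddCommGroup Z] : CubeStructure Z :=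
  fun n => (filteredCubes (maxFiltration Z k) n : Set (Cube n → Z))

end Nilspace

/-! Everything rests on a replacement principle, `IsNilspace.isCubeOn_replace`: if two cubes differ
only on a face, the second may be substituted there in any cube that agrees with the first on that
face. It follows from completing partial cubes given on lower sets of vertices.

For a face that is a single vertex, it makes `∼_j`-equivalent values interchangeable in cubes of
dimension `j + 1`. Hence `∼_j` is an equivalence relation, and every map from `{0,1}^(j+1)` into one
class is a cube, because constants are. So the classes of `∼_(k-1)` are `k`-step and `k`-fold
ergodic, and (2) reduces to (1).

For (1), the cubes of dimension `k + 1` determine both structures: in `X` by unique completion, in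
`D_k(Z)` because its cubes are the maps with zero alternating sums. By ergodicity a cube of
dimension `k + 1` has one value determined by the others, which are arbitrary. For `k ≥ 1`, fix `e`
and consider the quadruples that fill a 2-face of such a cube with `e` elsewhere. Replacement along
an edge makes this relation transitive, so it is `x + w = y + z` in an abelian group with zero `e`.
It also allows a constant to be subtracted along an edge, which changes no alternating sum. Clearing
a cube in this way shows that its alternating sum is zero, and uniqueness gives the converse. For `k
= 0`, `X` is a point. -/

namespace Nilspace
open Set

/-! ### Coordinate maps between cubes -/

/-- A Boolean function of the vertices of a cube which is constant, a coordinate, or the negation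
of a coordinate. -/
def IsCoord {κ : Type*} (f : (κ → Bool) → Bool) : Prop :=
  (∃ c, ∀ v, f v = c) ∨ (∃ j, ∀ v, f v = v j) ∨ ∃ j, ∀ v, f v = !v j

/-- A map of cubes all of whose coordinates are constants, coordinates or negated coordinates. -/
def CoordMap {ι κ : Type*} (φ : (κ → Bool) → (ι → Bool)) : Prop :=
  ∀ i, IsCoord fun v => φ v i

section Coord

variable {ι κ μ : Type*}

theorem IsCoord.const (c : Bool) : IsCoord fun _ : κ → Bool => c := Or.inl ⟨c, fun _ => rfl⟩

theorem IsCoord.proj (j : κ) : IsCoord fun v : κ → Bool => v j :=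
  Or.inr (Or.inl ⟨j, fun _ => rfl⟩)

theorem IsCoord.not {f : (κ → Bool) → Bool} (hf : IsCoord f) : IsCoord fun v => !f v := by
  rcases hf with ⟨c, h⟩ | ⟨j, h⟩ | ⟨j, h⟩
  · exact Or.inl ⟨!c, fun v => by simp [h]⟩
  · exact Or.inr (Or.inr ⟨j, fun v => by simp [h]⟩)
  · exact Or.inr (Or.inl ⟨j, fun v => by simp [h]⟩)

theorem IsCoord.and_const {f : (κ → Bool) → Bool} (hf : IsCoord f) (c : Bool) :
    IsCoord fun v => f v && c := by
  cases c
  · exact Or.inl ⟨false, fun v => by simp⟩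
  · simpa using hf

theorem IsCoord.xor_const {f : (κ → Bool) → Bool} (hf : IsCoord f) (c : Bool) :
    IsCoord fun v => xor (f v) c := by
  cases c
  · simpa using hf
  · simpa using hf.not

theorem IsCoord.ite {f g : (κ → Bool) → Bool} (p : Prop) [Decidable p] (hf : IsCoord f)
    (hg : IsCoord g) : IsCoord fun v => if p then f v else g v := by
  by_cases hp : p <;> simpa [hp]

theorem IsCoord.comp {f : (ι → Bool) → Bool} (hf : IsCoord f) {φ : (κ → Bool) → (ι → Bool)}
    (hφ : CoordMap φ) : IsCoord fun v => f (φ v) := by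
  rcases hf with ⟨c, h⟩ | ⟨j, h⟩ | ⟨j, h⟩
  · exact Or.inl ⟨c, fun v => h _⟩
  · simpa only [h] using hφ j
  · simpa only [h] using (hφ j).not

theorem CoordMap.comp {φ : (ι → Bool) → (μ → Bool)} (hφ : CoordMap φ)
    {ψ : (κ → Bool) → (ι → Bool)} (hψ : CoordMap ψ) : CoordMap (φ ∘ ψ) :=
  fun i => (hφ i).comp hψ

theorem CoordMap.id : CoordMap (id : (κ → Bool) → (κ → Bool)) := fun i => IsCoord.proj i

theorem coordMap_xor (s : κ → Bool) : CoordMap fun (v : κ → Bool) i => xor (v i) (s i) :=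
  fun i => (IsCoord.proj i).xor_const (s i)

theorem coordMap_insertNth {m : ℕ} (i : Fin (m + 1)) (c : Bool) :
    CoordMap fun v : Cube m => i.insertNth (α := fun _ => Bool) c v := by
  intro j
  rcases Fin.eq_self_or_eq_succAbove i j with rfl | ⟨l, rfl⟩
  · simpa using IsCoord.const c
  · simpa using IsCoord.proj l

theorem IsCoord.exists_affine {m : ℕ} {f : Cube m → Bool} (hf : IsCoord f) :
    ∃ (F : (Fin m → ℤ) →+ ℤ) (t : ℤ), ∀ v : Cube m, (f v).toInt = F v.toInt + t := by
  rcases hf with ⟨c, h⟩ | ⟨j, h⟩ | ⟨j, h⟩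
  · exact ⟨0, c.toInt, fun v => by simp [h]⟩
  · exact ⟨Pi.evalAddMonoidHom _ j, 0, fun v => by simp [h, Cube.toInt]⟩
  · exact ⟨-Pi.evalAddMonoidHom _ j, 1, fun v => by cases hv : v j <;> simp [h, Cube.toInt, hv]⟩

theorem CoordMap.isCubeMorphism {m n : ℕ} {φ : Cube m → Cube n} (hφ : CoordMap φ) :
    IsCubeMorphism φ := by
  choose F t h using fun i => (hφ i).exists_affine
  exact ⟨AddMonoidHom.mk' (fun x i => F i x) fun x y => by ext i; simp, t,
    fun v => funext fun i => h i v⟩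

end Coord

/-! ### Cubes over arbitrary sets of coordinates -/

/-- Cubes indexed by an arbitrary set of coordinates: the maps obtained from a cube by a
coordinate map. -/
def IsCubeOn (C : CubeStructure X) {ι : Type*} (q : (ι → Bool) → X) : Prop :=
  ∃ (n : ℕ) (φ : (ι → Bool) → Cube n), CoordMap φ ∧ ∃ p ∈ C n, q = p ∘ φ

section CubeOn

variable {C : CubeStructure X} {ι κ : Type*}

theorem IsCubeOn.comp {q : (ι → Bool) → X} (hq : IsCubeOn C q) {φ : (κ → Bool) → (ι → Bool)}
    (hφ : CoordMap φ) : IsCubeOn C (q ∘ φ) := by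
  obtain ⟨n, ψ, hψ, p, hp, rfl⟩ := hq
  exact ⟨n, ψ ∘ φ, hψ.comp hφ, p, hp, rfl⟩

theorem IsCubeOn.of_mem {n : ℕ} {q : Cube n → X} (hq : q ∈ C n) : IsCubeOn C q :=
  ⟨n, _, CoordMap.id, q, hq, rfl⟩

theorem IsNilspace.comp_mem (hC : IsNilspace C) {m n : ℕ} {q : Cube n → X} (hq : q ∈ C n)
    {φ : Cube m → Cube n} (hφ : CoordMap φ) : q ∘ φ ∈ C m :=
  hC.composition φ hφ.isCubeMorphism q hq

theorem IsCubeOn.mem (hC : IsNilspace C) {n : ℕ} {q : Cube n → X} (hq : IsCubeOn C q) :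
    q ∈ C n := by
  obtain ⟨m, φ, hφ, p, hp, rfl⟩ := hq
  exact hC.comp_mem hp hφ

theorem IsNilspace.isCubeOn_const (hC : IsNilspace C) (x : X) :
    IsCubeOn C fun _ : ι → Bool => x := by
  refine ⟨1, fun _ => vertexZero 1, fun _ => IsCoord.const _, fun _ => x, ?_, rfl⟩
  have h := hC.ergodicity
  rw [IsErgodic] at h
  rw [h]
  trivial

theorem IsNilspace.const_mem (hC : IsNilspace C) (x : X) (n : ℕ) :
    (fun _ : Cube n => x) ∈ C n := (hC.isCubeOn_const x).mem hC

end CubeOn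

/-! ### Completion over lower sets -/

/-- In a finite order, a property of the whole set descends to every lower set if it can be
passed from `insert s S` to `S` for each minimal element `s` of the complement of `S`. -/
theorem lowerSet_induction {α : Type*} [PartialOrder α] [Finite α] {P : Set α → Prop}
    (huniv : P Set.univ)
    (step : ∀ S, IsLowerSet S → ∀ s ∉ S, (∀ t < s, t ∈ S) → P (insert s S) → P S)
    (S : Set α) (hS : IsLowerSet S) : P S := by
  induction S using WellFoundedGT.induction with
  | ind S ih =>
    by_cases h : S = Set.univ
    · rwa [h]
    obtain ⟨s, hs⟩ := (Set.toFinite Sᶜ).exists_minimal (Set.nonempty_compl.mpr h)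
    have hlt : ∀ t < s, t ∈ S := fun t ht => by
      by_contra h'
      exact ht.not_ge (hs.2 h' ht.le)
    refine step S hS s hs.1 hlt (ih _ (Set.ssubset_insert hs.1) ?_)
    rintro a b hba (rfl | ha)
    · rcases hba.lt_or_eq with h | h
      · exact Or.inr (hlt b h)
      · exact Or.inl h
    · exact Or.inr (hS hba ha)

section Completion

variable {C : CubeStructure X} {ι : Type*} [Finite ι]

/-- The face below `s` is a cube of dimension the number of `1`s of `s`, and `q` is a corner on it;
its completion supplies `x`. Composing with `v ↦ v ⊓ s` expresses restriction to this face without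
changing the coordinate set. -/
theorem IsNilspace.exists_update_isCubeOn (hC : IsNilspace C) [DecidableEq (ι → Bool)]
    (q : (ι → Bool) → X) (s : ι → Bool)
    (h : ∀ t < s, IsCubeOn C fun v => q (v ⊓ t)) :
    ∃ x, IsCubeOn C fun v => Function.update q s x (v ⊓ s) := by
  classical
  obtain ⟨m, ⟨e⟩⟩ := Finite.exists_equiv_fin {i // s i = true}
  cases m with
  | zero =>
    have hs : ∀ i, s i = false := fun i => by
      by_contra hi
      exact (e ⟨i, by simpa using hi⟩).elim0
    have hs' : ∀ v : ι → Bool, v ⊓ s = s := fun v => by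
      ext i
      simp [hs]
    exact ⟨q s, by simpa [hs'] using hC.isCubeOn_const (q s)⟩
  | succ m =>
    let ψ : Cube (m + 1) → (ι → Bool) := fun v i => if hi : s i = true then v (e ⟨i, hi⟩) else false
    have hψ : CoordMap ψ := fun i => by
      by_cases hi : s i = true
      · simpa [ψ, hi] using IsCoord.proj _
      · simpa [ψ, hi] using IsCoord.const _
    let ρ : (ι → Bool) → Cube (m + 1) := fun w j => w (e.symm j)
    have hρ : CoordMap ρ := fun j => IsCoord.proj _
    have hψρ : ∀ w, ψ (ρ w) = w ⊓ s := fun w => by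
      ext i
      by_cases hi : s i = true <;> simp [ψ, ρ, hi]
    have hψs : ∀ v, ψ v = s → v = vertexOne (m + 1) := fun v hv => by
      ext j
      have := congrFun hv (e.symm j)
      have hj := (e.symm j).2
      simpa [ψ, hj, vertexOne] using this
    have hcorner : IsCorner C (q ∘ ψ) := by
      intro i
      let ins : Cube m → Cube (m + 1) := fun v => i.insertNth (α := fun _ => Bool) false v
      have hins : CoordMap ins := coordMap_insertNth i false
      have hlt : ψ (ins (vertexOne m)) < s := by
        refine lt_of_le_of_ne ?_ fun h' => ?_
        · intro j
          by_cases hj : s j = true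
          · rw [hj]; exact Bool.le_true _
          · simp [ψ, hj]
        · have := congrFun (hψs _ h') i
          simp [ins, vertexOne] at this
      have key := ((h _ hlt).comp (hψ.comp hins)).mem hC
      convert key using 2 with v
      simp only [Function.comp]
      congr 1
      ext j
      by_cases hj : s j = true
      · simp only [ψ, hj, dif_pos, Pi.inf_apply]
        rcases Fin.eq_self_or_eq_succAbove i (e ⟨j, hj⟩) with h' | ⟨l, h'⟩ <;>
          simp [ins, h', vertexOne]
      · simp [ψ, hj]
    obtain ⟨p, hp, hpq⟩ := hC.corner_completion _ hcorner
    refine ⟨p (vertexOne _), ?_⟩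
    convert (IsCubeOn.of_mem hp).comp hρ using 1
    funext w
    by_cases hw : w ⊓ s = s
    · have : ρ w = vertexOne _ := hψs _ (by rw [hψρ, hw])
      simp [hw, this]
    · have : ρ w ≠ vertexOne _ := fun h' => hw (by
        rw [← hψρ, h']
        ext i
        by_cases hi : s i = true <;> simp [ψ, hi, vertexOne])
      simp [hw, hpq _ this, hψρ]

/-- Completion of a map which is a cube below each vertex of a lower set. -/
theorem IsNilspace.exists_isCubeOn_of_lowerSet (hC : IsNilspace C) {S : Set (ι → Bool)}
    (hS : IsLowerSet S) (q : (ι → Bool) → X)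
    (h : ∀ s ∈ S, IsCubeOn C fun v => q (v ⊓ s)) :
    ∃ Q : (ι → Bool) → X, IsCubeOn C Q ∧ ∀ s ∈ S, Q s = q s := by
  classical
  revert q
  refine lowerSet_induction (P := fun S => ∀ q : (ι → Bool) → X,
    (∀ s ∈ S, IsCubeOn C fun v => q (v ⊓ s)) →
      ∃ Q : (ι → Bool) → X, IsCubeOn C Q ∧ ∀ s ∈ S, Q s = q s) ?_ ?_ S hS
  · intro q h
    exact ⟨q, by simpa using h ⊤ trivial, fun _ _ => rfl⟩
  · intro S hS s hs hlt ih q h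
    obtain ⟨x, hx⟩ := hC.exists_update_isCubeOn q s fun t ht => h t (hlt t ht)
    have hne : ∀ t ∈ S, t ≠ s := fun t ht h' => hs (h' ▸ ht)
    obtain ⟨Q, hQ, hQq⟩ := ih (Function.update q s x) (by
      rintro t (rfl | ht)
      · exact hx
      · convert h t ht using 2 with v
        exact Function.update_of_ne (hne _ (hS inf_le_right ht)) _ _)
    exact ⟨Q, hQ, fun t ht => by
      rw [hQq t (Or.inr ht), Function.update_of_ne (hne t ht)]⟩

end Completion

/-! ### Gluing cubes and replacing faces -/

section Replacement

variable {C : CubeStructure X} {ι : Type*} [Finite ι]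

-- The directions in `A` are doubled: `q` uses the left copy, `r` the right one, each being
-- prescribed where the other copy vanishes. By `hqr` the prescriptions agree where they overlap,
-- and they live on a lower set, so a completion exists.
open Classical in
theorem IsNilspace.isCubeOn_glue (hC : IsNilspace C) (A : Set ι) {q r : (ι → Bool) → X}
    (hq : IsCubeOn C q) (hr : IsCubeOn C r)
    (hqr : ∀ v, (∀ i ∈ A, v i = false) → q v = r v) :
    ∃ R : (ι ⊕ ι → Bool) → X, IsCubeOn C R ∧
      (∀ w, (∀ i ∈ A, w (Sum.inr i) = false) → R w = q fun i => w (Sum.inl i)) ∧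
      ∀ w, (∀ i ∈ A, w (Sum.inl i) = false) →
        R w = r fun i => if i ∈ A then w (Sum.inr i) else w (Sum.inl i) := by
  let T : Set (ι ⊕ ι → Bool) :=
    {w | (∀ i ∈ A, w (Sum.inr i) = false) ∨ ∀ i ∈ A, w (Sum.inl i) = false}
  have hT : IsLowerSet T := by
    have aux : ∀ {a b : Bool}, b ≤ a → a = false → b = false := by decide
    rintro a b hba (h | h)
    · exact Or.inl fun i hi => aux (hba _) (h i hi)
    · exact Or.inr fun i hi => aux (hba _) (h i hi)
  let R₀ : (ι ⊕ ι → Bool) → X := fun w =>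
    if ∀ i ∈ A, w (Sum.inr i) = false then q fun i => w (Sum.inl i)
    else r fun i => if i ∈ A then w (Sum.inr i) else w (Sum.inl i)
  have hR₁ : ∀ w, (∀ i ∈ A, w (Sum.inr i) = false) → R₀ w = q fun i => w (Sum.inl i) :=
    fun w hw => if_pos hw
  have hR₂ : ∀ w, (∀ i ∈ A, w (Sum.inl i) = false) →
      R₀ w = r fun i => if i ∈ A then w (Sum.inr i) else w (Sum.inl i) := fun w hw => by
    by_cases h : ∀ i ∈ A, w (Sum.inr i) = false
    · rw [hR₁ w h, hqr _ hw]
      congr 1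
      ext i
      by_cases hi : i ∈ A <;> simp [hi, hw, h]
    · exact if_neg h
  obtain ⟨R, hR, hRR⟩ := hC.exists_isCubeOn_of_lowerSet hT R₀ (by
    rintro t (ht | ht)
    · have : (fun v : ι ⊕ ι → Bool => R₀ (v ⊓ t)) =
          q ∘ fun v i => v (Sum.inl i) && t (Sum.inl i) := by
        funext v
        exact hR₁ _ fun i hi => by simp [ht i hi]
      rw [this]
      exact hq.comp fun i => (IsCoord.proj _).and_const _
    · have : (fun v : ι ⊕ ι → Bool => R₀ (v ⊓ t)) = r ∘ fun v i =>
          if i ∈ A then v (Sum.inr i) && t (Sum.inr i) else v (Sum.inl i) && t (Sum.inl i) := by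
        funext v
        exact hR₂ _ fun i hi => by simp [ht i hi]
      rw [this]
      exact hr.comp fun i => ((IsCoord.proj _).and_const _).ite _ ((IsCoord.proj _).and_const _))
  exact ⟨R, hR, fun w hw => (hRR w (Or.inl hw)).trans (hR₁ w hw),
    fun w hw => (hRR w (Or.inr hw)).trans (hR₂ w hw)⟩

-- Each direction in `A` is subdivided: of the three pairs allowed in `S`, `(0,0)` is the midpoint
-- and `(1,0)`, `(0,1)` are the ends. The piece towards `(1,0)` in all these directions carries
-- `r₁`, the others the gluing of `q` and `r₀`; they fit since `r₀ = r₁` off the face. The cube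
-- spanned by the ends is the required one.
open Classical in
theorem IsNilspace.isCubeOn_replace_zero (hC : IsNilspace C) (A : Set ι)
    {q r₀ r₁ : (ι → Bool) → X} (hq : IsCubeOn C q) (h₀ : IsCubeOn C r₀) (h₁ : IsCubeOn C r₁)
    (hr : ∀ v, (¬∀ i ∈ A, v i = false) → r₀ v = r₁ v)
    (hqr : ∀ v, (∀ i ∈ A, v i = false) → q v = r₀ v) :
    IsCubeOn C fun v => if ∀ i ∈ A, v i = false then r₁ v else q v := by
  obtain ⟨R, hR, hRq, hRr⟩ := hC.isCubeOn_glue A hq h₀ hqr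
  let S : Set (ι ⊕ ι → Bool) := {w | ∀ i ∈ A, w (Sum.inl i) = false ∨ w (Sum.inr i) = false}
  have hS : IsLowerSet S := by
    have aux : ∀ {a b : Bool}, b ≤ a → a = false → b = false := by decide
    intro a b hba h i hi
    exact (h i hi).imp (aux (hba _)) (aux (hba _))
  -- In a direction of `A`, the end `(1,0)` goes to `(0,0)`, the midpoint `(0,0)` to `(0,1)` and the
  -- end `(0,1)` to `(1,0)`. This need not be a coordinate map, but it is one below each vertex of
  -- `S`.
  let U : (ι ⊕ ι → Bool) → (ι ⊕ ι → Bool) := fun w =>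
    Sum.elim (fun i => if i ∈ A then w (Sum.inr i) else w (Sum.inl i))
      (fun i => if i ∈ A then !w (Sum.inl i) && !w (Sum.inr i) else false)
  let p : (ι ⊕ ι → Bool) → X := fun w =>
    if ∀ i ∈ A, w (Sum.inl i) = true then r₁ fun i => if i ∈ A then false else w (Sum.inl i)
    else R (U w)
  obtain ⟨Q, hQ, hQp⟩ := hC.exists_isCubeOn_of_lowerSet hS p (by
    intro s hs
    by_cases h : ∀ i ∈ A, s (Sum.inl i) = true
    · have : (fun v : ι ⊕ ι → Bool => p (v ⊓ s)) = r₁ ∘ fun v i =>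
          if i ∈ A then !v (Sum.inl i) else v (Sum.inl i) && s (Sum.inl i) := by
        have hs' : ∀ i ∈ A, s (Sum.inr i) = false := fun i hi => by simpa [h i hi] using hs i hi
        funext v
        by_cases hv : ∀ i ∈ A, v (Sum.inl i) = true
        · have : ∀ i ∈ A, (v ⊓ s) (Sum.inl i) = true := fun i hi => by simp [hv i hi, h i hi]
          simp only [p]
          rw [if_pos this]
          simp only [Function.comp]
          congr 1
          ext i
          by_cases hi : i ∈ A <;> simp [hi, hv]
        · have h' : ¬∀ i ∈ A, (v ⊓ s) (Sum.inl i) = true := fun h' => hv fun i hi => by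
            have := h' i hi
            simp at this
            exact this.1
          simp only [p]
          rw [if_neg h', hRr _ fun i hi => by simp [U, hi, hs' i hi], Function.comp, ← hr]
          · congr 1
            ext i
            by_cases hi : i ∈ A <;> simp [U, hi, h i, hs' i]
          · intro h''
            exact hv fun i hi => by simpa [hi] using h'' i hi
      rw [this]
      exact h₁.comp fun i => (IsCoord.proj _).not.ite _ ((IsCoord.proj _).and_const _)
    · have : (fun v : ι ⊕ ι → Bool => p (v ⊓ s)) = R ∘ fun v => U (v ⊓ s) := by
        funext v
        refine if_neg fun h' => h fun i hi => ?_
        have := h' i hi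
        simp at this
        exact this.2
      rw [this]
      refine hR.comp ?_
      rintro (i | i)
      · exact ((IsCoord.proj _).and_const _).ite _ ((IsCoord.proj _).and_const _)
      · by_cases hi : i ∈ A
        · rcases hs i hi with h' | h'
          · simpa [U, hi, h'] using ((IsCoord.proj (Sum.inr i)).and_const (s (Sum.inr i))).not
          · simpa [U, hi, h'] using ((IsCoord.proj (Sum.inl i)).and_const (s (Sum.inl i))).not
        · simpa [U, hi] using IsCoord.const _)
  -- The ends of the subdivision: in a direction of `A`, `0` goes to `(1,0)` and `1` to `(0,1)`.
  let diag : (ι → Bool) → (ι ⊕ ι → Bool) := fun z =>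
    Sum.elim (fun i => if i ∈ A then !z i else z i) (fun i => if i ∈ A then z i else false)
  have hdiag : CoordMap diag := by
    rintro (i | i)
    · exact (IsCoord.proj i).not.ite _ (IsCoord.proj i)
    · exact (IsCoord.proj i).ite _ (IsCoord.const _)
  convert hQ.comp hdiag using 1
  funext z
  have hz : diag z ∈ S := fun i hi => by cases h : z i <;> simp [diag, hi, h]
  rw [Function.comp, hQp _ hz]
  by_cases h : ∀ i ∈ A, z i = false
  · rw [if_pos h]
    simp only [p]
    rw [if_pos fun i hi => by simp [diag, hi, h i hi]]
    congr 1
    ext i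
    by_cases hi : i ∈ A <;> simp [diag, hi, h i]
  · rw [if_neg h]
    simp only [p]
    rw [if_neg, hRq]
    · congr 1
      ext i
      by_cases hi : i ∈ A <;> simp [diag, U, hi]
    · intro i hi
      simp [diag, U, hi]
    · intro h'
      exact h fun i hi => by simpa [diag, hi] using h' i hi

open Classical in
/-- If two cubes `r₀`, `r₁` differ only on the face through `s` in which the coordinates in `A`
are fixed, and `q` is a cube equal to `r₀` on that face, then `q` may be replaced by `r₁` there. -/
theorem IsNilspace.isCubeOn_replace (hC : IsNilspace C) (A : Set ι) (s : ι → Bool)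
    {q r₀ r₁ : (ι → Bool) → X} (hq : IsCubeOn C q) (h₀ : IsCubeOn C r₀) (h₁ : IsCubeOn C r₁)
    (hr : ∀ v, (¬∀ i ∈ A, v i = s i) → r₀ v = r₁ v)
    (hqr : ∀ v, (∀ i ∈ A, v i = s i) → q v = r₀ v) :
    IsCubeOn C fun v => if ∀ i ∈ A, v i = s i then r₁ v else q v := by
  have hx := coordMap_xor s
  have aux : ∀ a b : Bool, xor a b = b ↔ a = false := by decide
  have := (hC.isCubeOn_replace_zero A (hq.comp hx) (h₀.comp hx) (h₁.comp hx)
    (fun v hv => hr _ (by simpa only [aux] using hv))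
    (fun v hv => hqr _ (by simpa only [aux] using hv))).comp hx
  convert this using 1
  funext v
  simp

end Replacement

/-! ### Final faces and the relation `∼_j` -/

/-- Extend a vertex by `1`s, or truncate it. -/
def finalFace (m n : ℕ) : Cube m → Cube n := fun v i => if h : i.1 < m then v ⟨i, h⟩ else true

theorem coordMap_finalFace (m n : ℕ) : CoordMap (finalFace m n) := fun i => by
  by_cases h : i.1 < m
  · simpa only [finalFace, dif_pos h] using IsCoord.proj _
  · simpa only [finalFace, dif_neg h] using IsCoord.const _

theorem finalFace_eq_vertexOne {m n : ℕ} (h : m ≤ n) (v : Cube m) :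
    finalFace m n v = vertexOne n ↔ v = vertexOne m := by
  constructor
  · intro hv
    ext i
    simpa [finalFace, vertexOne] using congrFun hv ⟨i, by omega⟩
  · rintro rfl
    ext i
    by_cases h : i.1 < m <;> simp [finalFace, h, vertexOne]

theorem finalFace_section {m n : ℕ} (h : n ≤ m) (v : Cube n) :
    finalFace m n (finalFace n m v) = v := by
  ext i
  have : i.1 < m := by omega
  simp [finalFace, this]

section Sim

variable {C : CubeStructure X}

/-- In a `k`-step nilspace, cubes of dimension `k + 1` which agree off `1^(k+1)` are equal. -/
theorem IsStepNilspace.eq_of_forall_ne {k : ℕ} (hC : IsStepNilspace C k) {q q' : Cube (k + 1) → X}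
    (hq : q ∈ C (k + 1)) (hq' : q' ∈ C (k + 1)) (h : ∀ v, v ≠ vertexOne (k + 1) → q v = q' v) :
    q = q' := by
  have hcorner : IsCorner C q := fun i =>
    hC.comp_mem hq (coordMap_insertNth i false)
  exact (hC.unique_completion q hcorner).unique ⟨hq, fun _ _ => rfl⟩
    ⟨hq', fun v hv => (h v hv).symm⟩

/-- One value of a cube of dimension `j + 1` may be replaced by an equivalent one. -/
theorem IsNilspace.update_mem (hC : IsNilspace C) {j : ℕ} {q : Cube (j + 1) → X}
    (hq : q ∈ C (j + 1)) (s : Cube (j + 1)) {y : X} (hy : Sim C j (q s) y) :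
    Function.update q s y ∈ C (j + 1) := by
  classical
  obtain ⟨q₀, h₀, q₁, h₁, hx, hy, hqq⟩ := hy
  let τ : Cube (j + 1) → Cube (j + 1) := fun v i => xor (v i) (s i)
  have hτ : CoordMap τ := coordMap_xor s
  have aux : ∀ v, τ v = vertexZero (j + 1) ↔ v = s := fun v => by
    simp [τ, funext_iff, vertexZero]
  have hiff : ∀ v : Cube (j + 1), (∀ i ∈ Set.univ, v i = s i) ↔ v = s := fun v => by
    simp [funext_iff]
  have := (hC.isCubeOn_replace Set.univ s (.of_mem hq) ((IsCubeOn.of_mem h₀).comp hτ)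
    ((IsCubeOn.of_mem h₁).comp hτ)
    (fun v hv => hqq _ fun h => hv ((hiff v).2 ((aux v).1 h)))
    (fun v hv => by
      obtain rfl := (hiff v).1 hv
      rw [Function.comp, (aux v).2 rfl, hx])).mem hC
  convert this using 1
  funext v
  by_cases hv : v = s
  · subst hv
    simp [(aux v).2 rfl, hy]
  · rw [Function.update_of_ne hv, if_neg fun h => hv ((hiff v).1 h)]

/-- Transitivity is the real content: in the second cube witnessing `x ∼ y`, the value `y` at `0` is
replaced by `z`. -/
theorem IsNilspace.equivalence_sim (hC : IsNilspace C) (j : ℕ) : Equivalence (Sim C j) where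
  refl x := ⟨_, hC.const_mem x _, _, hC.const_mem x _, rfl, rfl, fun _ _ => rfl⟩
  symm := by
    rintro x y ⟨q₀, h₀, q₁, h₁, hx, hy, h⟩
    exact ⟨q₁, h₁, q₀, h₀, hy, hx, fun v hv => (h v hv).symm⟩
  trans := by
    classical
    rintro x y z ⟨q₀, h₀, q₁, h₁, hx, rfl, h⟩ hz
    exact ⟨q₀, h₀, _, hC.update_mem h₁ _ hz, hx, Function.update_self .., fun v hv => by
      rw [h v hv, Function.update_of_ne hv]⟩

/-- The values of a cube of dimension `j + 1` may be replaced by equivalent ones. -/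
theorem IsNilspace.mem_of_forall_sim (hC : IsNilspace C) {j : ℕ} {q q' : Cube (j + 1) → X}
    (hq : q ∈ C (j + 1)) (h : ∀ v, Sim C j (q v) (q' v)) : q' ∈ C (j + 1) := by
  classical
  have key : ∀ T : Finset (Cube (j + 1)), (fun v => if v ∈ T then q' v else q v) ∈ C (j + 1) := by
    intro T
    induction T using Finset.induction_on with
    | empty => simpa using hq
    | insert s T hs ih =>
      convert hC.update_mem ih s (y := q' s) (by simpa [hs] using h s) using 1
      funext v
      by_cases hv : v = s
      · subst hv; simp
      · simp [hv]
  simpa using key Finset.univ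

/-- If all values of a cube but that at `1^(j+1)` lie in a class of `∼_j`, then so does the
value at `1^(j+1)`. -/
theorem IsNilspace.sim_vertexOne (hC : IsNilspace C) {j : ℕ} {q : Cube (j + 1) → X} {x : X}
    (hq : q ∈ C (j + 1)) (h : ∀ v, v ≠ vertexOne (j + 1) → Sim C j x (q v)) :
    Sim C j x (q (vertexOne (j + 1))) := by
  classical
  have hE := hC.equivalence_sim j
  -- Moving the other values to `x` leaves a cube that is constant except at `1`; its reflection is
  -- compared with the constant cube.
  have h' : Function.update (fun _ => x) (vertexOne (j + 1))
      (q (vertexOne (j + 1))) ∈ C (j + 1) := by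
    refine hC.mem_of_forall_sim hq fun v => ?_
    by_cases hv : v = vertexOne (j + 1)
    · subst hv; simpa using hE.refl _
    · simpa [hv] using hE.symm (h v hv)
  have hn : CoordMap fun (v : Cube (j + 1)) i => !v i := fun i => (IsCoord.proj i).not
  refine ⟨_, hC.const_mem x _, _, hC.comp_mem h' hn, rfl, ?_, fun v hv => ?_⟩
  · have : (fun i => !vertexZero (j + 1) i) = vertexOne (j + 1) := by
      ext i; simp [vertexZero, vertexOne]
    simp [this]
  · have : (fun i => !v i) ≠ vertexOne (j + 1) := fun h => hv (by
      ext i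
      simpa [vertexZero, vertexOne] using congrFun h i)
    simp [this]

/-- A class of `∼_j` is a `(j+1)`-step nilspace. -/
theorem IsStepNilspace.restrict_simClass {j : ℕ} (hC : IsStepNilspace C (j + 1)) (x : X) :
    IsStepNilspace (restrict C (simClass C j x)) (j + 1) := by
  have hN := hC.toIsNilspace
  have hE := hN.equivalence_sim j
  have herg : ∀ q : Cube (j + 1) → X, (∀ v, Sim C j x (q v)) → q ∈ C (j + 1) := fun q h =>
    hN.mem_of_forall_sim (hN.const_mem x _) h
  have hF : IsNilspace (restrict C (simClass C j x)) := by
    refine ⟨fun φ hφ q hq => hN.composition φ hφ _ hq, ?_, ?_⟩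
    · ext q
      have h := hN.ergodicity
      rw [IsErgodic] at h
      simp [restrict, h]
    · intro m q' hq'
      have hqX : IsCorner C fun v => (q' v : X) := hq'
      obtain ⟨q, hq, hqq⟩ := hN.corner_completion _ hqX
      -- Up to dimension `j + 1` every map into the class is a cube, by extension to dimension `j +
      -- 1` and restriction. Above it, a completion in `X` stays in the class, as seen on the final
      -- face of dimension `j + 1`.
      by_cases hm : m + 1 ≤ j + 1
      · refine ⟨q', ?_, fun _ _ => rfl⟩
        have := hN.comp_mem (herg (fun v => q' (finalFace _ _ v)) fun v => (q' _).2)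
          (coordMap_finalFace (m + 1) (j + 1))
        simpa [restrict, Function.comp_def, finalFace_section hm] using this
      · have h1 : Sim C j x (q (vertexOne (m + 1))) := by
          have hle : j + 1 ≤ m + 1 := by omega
          have := hN.sim_vertexOne (x := x) (hN.comp_mem hq (coordMap_finalFace (j + 1) (m + 1)))
            fun v hv => by
              rw [Function.comp, hqq _ fun h => hv ((finalFace_eq_vertexOne hle v).1 h)]
              exact (q' _).2
          rwa [Function.comp, (finalFace_eq_vertexOne hle _).2 rfl] at this
        have hF : ∀ v, q v ∈ simClass C j x := fun v => by
          by_cases hv : v = vertexOne _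
          · rw [hv]; exact h1
          · rw [hqq v hv]; exact (q' v).2
        exact ⟨fun v => ⟨q v, hF v⟩, hq, fun v hv => Subtype.ext (hqq v hv)⟩
  refine ⟨hF, fun q' hq' => ?_⟩
  obtain ⟨q, hq⟩ := hF.corner_completion q' hq'
  refine ⟨q, hq, fun p hp => funext fun v => Subtype.ext ?_⟩
  exact congrFun (hC.eq_of_forall_ne hp.1 hq.1 fun v hv =>
    congrArg Subtype.val ((hp.2 v hv).trans (hq.2 v hv).symm)) v

theorem IsNilspace.isErgodic_simClass (hC : IsNilspace C) (j : ℕ) (x : X) :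
    IsErgodic (restrict C (simClass C j x)) (j + 1) := by
  refine Set.eq_univ_of_forall fun q => ?_
  exact hC.mem_of_forall_sim (hC.const_mem x _) fun v => (q v).2

end Sim

/-! ### Reduction to dimension `k + 1` -/

section StepNilspace

variable {C : CubeStructure X} {k : ℕ}

/-- In a `k`-step nilspace, the cubes are determined by those of dimension `k + 1`. -/
theorem IsStepNilspace.mem_iff (hC : IsStepNilspace C k) {n : ℕ} {q : Cube n → X} :
    q ∈ C n ↔ ∀ φ : Cube (k + 1) → Cube n, CoordMap φ → q ∘ φ ∈ C (k + 1) := by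
  refine ⟨fun hq φ hφ => hC.comp_mem hq hφ, ?_⟩
  induction n with
  | zero =>
    intro h
    have := hC.comp_mem (h _ (coordMap_finalFace _ _)) (coordMap_finalFace 0 (k + 1))
    convert this using 1
    funext v
    simp [finalFace_section]
  | succ m ih =>
    intro h
    by_cases hm : m + 1 ≤ k + 1
    · have := hC.comp_mem (h _ (coordMap_finalFace _ _)) (coordMap_finalFace (m + 1) (k + 1))
      convert this using 1
      funext v
      simp [finalFace_section hm]
    -- By induction `q` is a corner. On the final face of dimension `k + 1`, both `q` and the
    -- completion `Q` are cubes, and they agree off `1`, hence also at `1`.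
    · obtain ⟨Q, hQ, hQq⟩ := hC.corner_completion q fun i =>
        ih fun φ hφ => h _ ((coordMap_insertNth i false).comp hφ)
      have hφ := coordMap_finalFace (k + 1) (m + 1)
      have heq := hC.eq_of_forall_ne (hC.comp_mem hQ hφ) (h _ hφ) fun v hv =>
        hQq _ fun h' => hv ((finalFace_eq_vertexOne (by omega) v).1 h')
      suffices Q = q from this ▸ hQ
      funext v
      by_cases hv : v = vertexOne _
      · have := congrFun heq (vertexOne _)
        rwa [Function.comp, Function.comp, (finalFace_eq_vertexOne (by omega) _).2 rfl,
          ← hv] at this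
      · exact hQq v hv

end StepNilspace

/-! ### Alternating sums and the degree-`k` structure -/

section AltSum

variable {Z : Type*} [AddCommGroup Z] {n : ℕ}

/-- The alternating sum of the values of a map on the vertices of a cube. -/
def altSum (q : Cube n → Z) : Z := ∑ v, (∏ i, if v i then (-1 : ℤ) else 1) • q v

theorem altSum_add (q q' : Cube n → Z) : altSum (q + q') = altSum q + altSum q' := by
  simp [altSum, Finset.sum_add_distrib]

theorem altSum_neg (q : Cube n → Z) : altSum (-q) = -altSum q := by
  simp [altSum]

theorem altSum_zero : altSum (0 : Cube n → Z) = 0 := by simp [altSum]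

/-- The alternating sum of a map which does not depend on one of the coordinates is zero. -/
theorem altSum_eq_zero {q : Cube n → Z} (j : Fin n)
    (h : ∀ v, q (Function.update v j (!v j)) = q v) : altSum q = 0 := by
  refine Finset.sum_involution (fun v _ => Function.update v j (!v j)) ?_ ?_ ?_ ?_
  · intro v _
    rw [h, ← add_smul]
    have : (∏ i, if Function.update v j (!v j) i then (-1 : ℤ) else 1) =
        -∏ i, if v i then (-1 : ℤ) else 1 := by
      rw [← Finset.mul_prod_erase _ _ (Finset.mem_univ j),
        ← Finset.mul_prod_erase _ (fun i => if v i then (-1 : ℤ) else 1) (Finset.mem_univ j),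
        ← neg_mul]
      congr 1
      · cases v j <;> simp
      · refine Finset.prod_congr rfl fun i hi => ?_
        rw [Function.update_of_ne (Finset.ne_of_mem_erase hi)]
    rw [this, add_neg_cancel, zero_smul]
  · intro v _ _ h'
    have := congrFun h' j
    simp at this
  · intros; exact Finset.mem_univ _
  · intro v _
    simp

/-- A map supported at a single vertex whose alternating sum is zero vanishes. -/
theorem eq_zero_of_altSum_eq_zero {q : Cube n → Z} (s : Cube n) (h : ∀ v, v ≠ s → q v = 0)
    (hq : altSum q = 0) : q s = 0 := by
  rw [altSum, Finset.sum_eq_single s (fun v _ hv => by rw [h v hv, smul_zero]) (by simp)] at hq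
  have hu : IsUnit (∏ i, if s i then (-1 : ℤ) else 1) := by
    rw [IsUnit.prod_iff]
    intro i _
    split_ifs <;> simp
  rcases Int.isUnit_iff.1 hu with h | h <;> rw [h] at hq <;> simpa using hq

/-- Each coordinate of `φ` depends on at most one variable, so at most `k` of the `k + 1` variables
affect membership in the face. The terms cancel in pairs along a remaining variable. -/
theorem altSum_indicator_face {k : ℕ} (I : Finset (Fin n)) (hI : I.card ≤ k) (x : Cube n) (g : Z)
    {φ : Cube (k + 1) → Cube n} (hφ : CoordMap φ) :
    altSum ((face I x).indicator (fun _ => g) ∘ φ) = 0 := by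
  classical
  have hdep : ∀ i, ∃ T : Finset (Fin (k + 1)), T.card ≤ 1 ∧
      ∀ j ∉ T, ∀ v, φ (Function.update v j (!v j)) i = φ v i := by
    intro i
    rcases hφ i with ⟨c, h⟩ | ⟨l, h⟩ | ⟨l, h⟩
    · exact ⟨∅, by simp, fun j _ v => by simp only [h]⟩
    · exact ⟨{l}, by simp, fun j hj v => by
        simp only [h]; rw [Function.update_of_ne (by simpa [eq_comm] using hj)]⟩
    · exact ⟨{l}, by simp, fun j hj v => by
        simp only [h]; rw [Function.update_of_ne (by simpa [eq_comm] using hj)]⟩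
  choose T hT hTd using hdep
  have hcard : (I.biUnion T).card ≤ k :=
    (Finset.card_biUnion_le_card_mul I T 1 fun i _ => hT i).trans (by omega)
  obtain ⟨j, hj⟩ : ∃ j, j ∉ I.biUnion T := by
    by_contra! h
    have : I.biUnion T = Finset.univ := Finset.eq_univ_of_forall h
    rw [this, Finset.card_univ, Fintype.card_fin] at hcard
    omega
  refine altSum_eq_zero j fun v => ?_
  have : φ (Function.update v j (!v j)) ∈ face I x ↔ φ v ∈ face I x :=
    forall₂_congr fun i hi => by
      rw [hTd i j (fun h => hj (Finset.mem_biUnion.2 ⟨i, hi, h⟩))]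
  by_cases h : φ v ∈ face I x
  · simp [h, this.2 h]
  · have h' := mt this.1 h
    simp [h, h']

/-- The cubes of the degree-`k` structure are the maps whose alternating sum over each
`(k+1)`-dimensional face vanishes. -/
theorem mem_degreeStructure_iff {k : ℕ} {q : Cube n → Z} :
    q ∈ degreeStructure k Z n ↔
      ∀ φ : Cube (k + 1) → Cube n, CoordMap φ → altSum (q ∘ φ) = 0 := by
  classical
  change q ∈ filteredCubes (maxFiltration Z k) n ↔ _
  constructor
  · intro hq φ hφ
    induction hq using AddSubgroup.closure_induction with
    | mem c hc =>
      obtain ⟨I, x, g, hg, rfl⟩ := hc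
      by_cases hI : I.card ≤ k
      · exact altSum_indicator_face I hI x g hφ
      · have : g = 0 := by simpa [maxFiltration, hI] using hg
        subst this
        have : (face I x).indicator (fun _ => (0 : Z)) ∘ φ = 0 := by ext; simp
        rw [this, altSum_zero]
    | zero => exact altSum_zero
    | add a b _ _ ha hb => rw [Pi.add_comp, altSum_add, ha, hb, add_zero]
    | neg a _ ha => rw [Pi.neg_comp, altSum_neg, ha, neg_zero]
  -- The values of `q` are cleared from `0^n` upwards, modulo generators.
  · have key := lowerSet_induction (α := Cube n) (P := fun S => ∀ q : Cube n → Z,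
      (∀ φ : Cube (k + 1) → Cube n, CoordMap φ → altSum (q ∘ φ) = 0) →
        (∀ v ∈ S, q v = 0) → q ∈ filteredCubes (maxFiltration Z k) n) ?_ ?_ ∅ isLowerSet_empty
    · exact fun h => key q h (by simp)
    · intro q _ h
      have : q = 0 := funext fun v => h v trivial
      rw [this]
      exact zero_mem _
    · intro S hS s hs hlt ih q hq hqS
      let I : Finset (Fin n) := Finset.univ.filter fun i => s i = true
      by_cases hI : I.card ≤ k
      -- This face consists of the vertices above `s`, so it misses `S` and subtracting `c` keeps
      -- the zeros already obtained.
      · let c : Cube n → Z := (face I s).indicator fun _ => q s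
        have hc : c ∈ filteredCubes (maxFiltration Z k) n :=
          AddSubgroup.subset_closure ⟨I, s, q s, by simp [maxFiltration, hI], rfl⟩
        have hd : q + -c ∈ filteredCubes (maxFiltration Z k) n := by
          refine ih _ (fun φ hφ => ?_) ?_
          · rw [Pi.add_comp, Pi.neg_comp, altSum_add, altSum_neg, hq φ hφ,
              altSum_indicator_face I hI s _ hφ, neg_zero, add_zero]
          · rintro v (rfl | hv)
            · have : v ∈ face I v := fun _ _ => rfl
              simp [c, this]
            · have : v ∉ face I s := fun h => hs (hS (fun i => by
                by_cases hi : s i = true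
                · rw [h i (by simpa [I] using hi)]
                · simp [hi]) hv)
              simp [c, this, hqS v hv]
        simpa using add_mem hd hc
      · refine ih q hq ?_
        rintro v (rfl | hv)
        -- With `k + 1` or more `1`s, the vertex is the top of a face of dimension `k + 1` whose
        -- other vertices lie in `S`. The alternating sum over it forces the value to be zero.
        · let g := I.orderEmbOfCardLe (k := k + 1) (by omega)
          have hg : ∀ j, v (g j) = true := fun j => by
            simpa [I] using I.orderEmbOfCardLe_mem (k := k + 1) (by omega) j
          let φ : Cube (k + 1) → Cube n := fun w i =>
            if h : ∃ j, g j = i then w h.choose else v i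
          have hφg : ∀ w j, φ w (g j) = w j := fun w j => by
            have h : ∃ l, g l = g j := ⟨j, rfl⟩
            simp only [φ, dif_pos h]
            rw [g.injective h.choose_spec]
          have hφn : ∀ w i, (¬∃ j, g j = i) → φ w i = v i := fun w i h => dif_neg h
          have hφ : CoordMap φ := fun i => by
            by_cases h : ∃ j, g j = i
            · obtain ⟨j, rfl⟩ := h
              simpa only [hφg] using IsCoord.proj j
            · simpa only [hφn _ _ h] using IsCoord.const _
          have hone : φ (vertexOne _) = v := by
            ext i
            by_cases h : ∃ j, g j = i
            · obtain ⟨j, rfl⟩ := h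
              rw [hφg, hg, vertexOne]
            · rw [hφn _ _ h]
          have := eq_zero_of_altSum_eq_zero (q := q ∘ φ) (vertexOne _) (fun w hw => ?_) (hq φ hφ)
          · rwa [Function.comp, hone] at this
          · refine hqS _ (hlt _ (lt_of_le_of_ne ?_ fun h => hw ?_))
            · intro i
              by_cases h : ∃ j, g j = i
              · obtain ⟨j, rfl⟩ := h
                rw [hg]; exact Bool.le_true _
              · rw [hφn _ _ h]
            · ext j
              rw [← hφg w j, h, hg, vertexOne]
        · exact hqS v hv

end AltSum

/-! ### Abelian groups from parallelograms -/

/-- A relation with the formal properties of `y - x = w - z` comes from an abelian group. -/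
theorem exists_addCommGroup_of_parallelogram (P : X → X → X → X → Prop) (e : X)
    (ex : ∀ x y z, ∃ w, P x y z w) (uniq : ∀ x y z w w', P x y z w → P x y z w' → w = w')
    (swap : ∀ x y z w, P x y z w → P x z y w) (symm : ∀ x y z w, P x y z w → P z w x y)
    (refl : ∀ x z, P x x z z)
    (trans : ∀ x y z w u v, P x y z w → P z w u v → P x y u v) :
    ∃ _ : AddCommGroup X, (0 : X) = e ∧ ∀ x y z w, P x y z w ↔ x + w = y + z := by
  -- The sum of `x` and `y` is the fourth vertex of the parallelogram on `e`, `x`, `y`.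
  choose add hadd using ex e
  choose neg hneg using fun x => ex x e e
  have hcomm : ∀ x y, add x y = add y x := fun x y =>
    uniq _ _ _ _ _ (hadd x y) (swap _ _ _ _ (hadd y x))
  have hzero : ∀ x, add e x = x := fun x => uniq _ _ _ _ _ (hadd e x) (refl e x)
  -- Both bracketings are the fourth vertex for `y`, `y + z`, `x + y`.
  have hassoc : ∀ x y z, add (add x y) z = add x (add y z) := fun x y z => by
    have h₁ : P y (add y z) (add x y) (add (add x y) z) :=
      trans _ _ _ _ _ _ (symm _ _ _ _ (swap _ _ _ _ (hadd y z))) (swap _ _ _ _ (hadd (add x y) z))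
    have h₂ : P y (add x y) (add y z) (add x (add y z)) :=
      trans _ _ _ _ _ _ (symm _ _ _ _ (hadd x y)) (hadd x (add y z))
    exact uniq _ _ _ _ _ h₁ (swap _ _ _ _ h₂)
  have hnegadd : ∀ x, add (neg x) x = e := fun x => by
    have h : P e (neg x) x e := symm _ _ _ _ (swap _ _ _ _ (hneg x))
    exact uniq _ _ _ _ _ (hadd (neg x) x) h
  let _ : Add X := ⟨add⟩
  let _ : Zero X := ⟨e⟩
  let _ : Neg X := ⟨neg⟩
  let G : AddCommGroup X :=
    { AddGroup.ofLeftAxioms hassoc hzero hnegadd with add_comm := hcomm }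
  have hP : ∀ x y z w, P x y z w → x + w = y + z := fun x y z w h => by
    obtain ⟨d, hd⟩ := ex x y e
    have hy : y = add d x := uniq _ _ _ _ _ (symm _ _ _ _ hd) (hadd d x)
    have hw : w = add d z :=
      uniq _ _ _ _ _ (trans _ _ _ _ _ _ (symm _ _ _ _ hd) h) (hadd d z)
    change y = d + x at hy
    change w = d + z at hw
    rw [hy, hw]
    abel
  refine ⟨G, rfl, fun x y z w => ⟨hP x y z w, fun h => ?_⟩⟩
  obtain ⟨w', hw'⟩ := ex x y z
  have : w = w' := add_left_cancel (h.trans (hP _ _ _ _ hw').symm)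
  rwa [this]

/-! ### Ergodic step nilspaces -/

section Ergodic

variable {C : CubeStructure X} {k : ℕ}

/-- Under `k`-fold ergodicity every map on `{0,1}^(k+1)` is a corner, and a reflection moves `s` to
`1^(k+1)`. -/
theorem IsStepNilspace.existsUnique_update (hC : IsStepNilspace C k) (hE : IsErgodic C k)
    (q : Cube (k + 1) → X) (s : Cube (k + 1)) :
    ∃! x, Function.update q s x ∈ C (k + 1) := by
  let τ : Cube (k + 1) → Cube (k + 1) := fun v i => xor (v i) (!s i)
  have hτ : CoordMap τ := coordMap_xor fun i => !s i
  have hττ : ∀ v, τ (τ v) = v := fun v => by ext i; simp [τ]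
  have hτs : ∀ v, τ v = vertexOne (k + 1) ↔ v = s := fun v => by
    have aux : ∀ a b : Bool, xor a (!b) = true ↔ a = b := by decide
    simp only [τ, vertexOne, funext_iff, aux]
  have hτ1 : τ (vertexOne _) = s := by rw [← (hτs s).2 rfl, hττ]
  obtain ⟨Q, ⟨hQ, hQq⟩, hun⟩ := hC.unique_completion (q ∘ τ) fun i => by
    rw [IsErgodic] at hE
    rw [hE]
    trivial
  refine ⟨Q (vertexOne _), ?_, fun y hy => ?_⟩
  · convert hC.comp_mem hQ hτ using 1
    funext v
    by_cases hv : v = s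
    · subst hv
      simp [(hτs v).2 rfl]
    · rw [Function.update_of_ne hv, Function.comp, hQq _ (mt (hτs v).1 hv), Function.comp, hττ]
  · rw [← hun _ ⟨hC.comp_mem hy hτ, fun v hv => ?_⟩]
    · simp [hτ1]
    · rw [Function.comp, Function.update_of_ne, Function.comp]
      rw [Ne, ← hτs, hττ]
      exact hv

theorem IsStepNilspace.eq_of_mem (hC : IsStepNilspace C k) (hE : IsErgodic C k)
    {q q' : Cube (k + 1) → X} (s : Cube (k + 1)) (hq : q ∈ C (k + 1)) (hq' : q' ∈ C (k + 1))
    (h : ∀ v, v ≠ s → q v = q' v) : q = q' := by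
  have h' : Function.update q s (q' s) = q' := by
    funext v
    by_cases hv : v = s
    · subst hv; simp
    · rw [Function.update_of_ne hv, h v hv]
  have := (hC.existsUnique_update hE q s).unique (y₁ := q s) (y₂ := q' s) (by simpa using hq)
    (by rwa [h'])
  funext v
  by_cases hv : v = s
  · rw [hv, this]
  · exact h v hv

open Classical in
/-- The map with values `x, y, z, w` on the two-dimensional face through `s` in the directions
`i` and `j`, and `e` off that face. -/
def square {n : ℕ} (e : X) (i j : Fin n) (s : Cube n) (x y z w : X) : Cube n → X := fun v =>
  if ∀ l, l ≠ i → l ≠ j → v l = s l then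
    if v j = s j then if v i = s i then x else y else if v i = s i then z else w
  else e

/-- A permutation of the coordinates and a reflection carry one 2-face, with its base vertex and
directions, to the other. The parallelogram relation is thus independent of its position. -/
theorem square_mem_of_square_mem (hC : IsNilspace C) {n : ℕ} {e x y z w : X} {i j i' j' : Fin n}
    (hij : i ≠ j) (hij' : i' ≠ j') {s s' : Cube n} (h : square e i j s x y z w ∈ C n) :
    square e i' j' s' x y z w ∈ C n := by
  let σ : Equiv.Perm (Fin n) := (Equiv.swap i i').trans (Equiv.swap (Equiv.swap i i' j) j')
  have hj : σ j = j' := by simp [σ]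
  have hi : σ i = i' := by
    have h1 : i' ≠ Equiv.swap i i' j := fun h' => hij (by
      have : Equiv.swap i i' i = Equiv.swap i i' j := by rw [Equiv.swap_apply_left]; exact h'
      exact (Equiv.swap i i').injective this)
    simp only [σ, Equiv.trans_apply, Equiv.swap_apply_left]
    exact Equiv.swap_apply_of_ne_of_ne h1 hij'
  let φ : Cube n → Cube n := fun v l => xor (v (σ l)) (xor (s' (σ l)) (s l))
  have hφ : CoordMap φ := fun l => (IsCoord.proj _).xor_const _
  have hφs : ∀ v l, φ v l = s l ↔ v (σ l) = s' (σ l) := fun v l => by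
    have aux : ∀ a b c : Bool, xor a (xor b c) = c ↔ a = b := by decide
    exact aux _ _ _
  convert hC.comp_mem h hφ using 1
  funext v
  have hiff : (∀ l, l ≠ i → l ≠ j → φ v l = s l) ↔ ∀ l, l ≠ i' → l ≠ j' → v l = s' l := by
    simp only [hφs]
    constructor
    · intro h l h1 h2
      have := h (σ.symm l) (fun h' => h1 (by rw [← hi, ← h', σ.apply_symm_apply]))
        (fun h' => h2 (by rw [← hj, ← h', σ.apply_symm_apply]))
      rwa [σ.apply_symm_apply] at this
    · intro h l h1 h2
      exact h _ (fun h' => h1 (σ.injective (h'.trans hi.symm)))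
        (fun h' => h2 (σ.injective (h'.trans hj.symm)))
  simp only [hφs] at hiff
  simp only [square, Function.comp, hφs, hiff, hi, hj]

theorem square_swap {n : ℕ} (e : X) (i j : Fin n) (s : Cube n) (x y z w : X) :
    square e i j s x y z w = square e j i s x z y w := by
  funext v
  simp only [square, forall_comm (α := _ ≠ i)]
  split_ifs <;> rfl

theorem square_symm {n : ℕ} (e : X) {i j : Fin n} (hij : i ≠ j) (s : Cube n) (x y z w : X) :
    square e i j s x y z w = square e i j (Function.update s j (!s j)) z w x y := by
  funext v
  have h1 : (∀ l, l ≠ i → l ≠ j → v l = Function.update s j (!s j) l) ↔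
      ∀ l, l ≠ i → l ≠ j → v l = s l :=
    forall₃_congr fun l _ h => by rw [Function.update_of_ne h]
  have h2 : v j = !s j ↔ ¬v j = s j := by cases v j <;> cases s j <;> simp
  simp only [square, h1, Function.update_self, Function.update_of_ne hij, h2]
  split_ifs <;> rfl

/-- The map does not depend on coordinate `i`, so it comes from a map on `{0,1}^k`, a cube by
ergodicity. -/
theorem square_self_mem (hC : IsNilspace C) (hE : IsErgodic C k) (e x z : X)
    (i j : Fin (k + 1)) (hij : i ≠ j) (s : Cube (k + 1)) : square e i j s x x z z ∈ C (k + 1) := by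
  let ins : Cube k → Cube (k + 1) := fun v => i.insertNth (α := fun _ => Bool) false v
  have h : square e i j s x x z z ∘ ins ∈ C k := by
    rw [IsErgodic] at hE
    rw [hE]
    trivial
  have hφ : CoordMap fun (v : Cube (k + 1)) l => v (i.succAbove l) := fun l => IsCoord.proj _
  convert hC.comp_mem h hφ using 1
  funext v
  have hv : ∀ l, l ≠ i → ins (fun l => v (i.succAbove l)) l = v l := fun l hl => by
    obtain ⟨m, rfl⟩ := Fin.exists_succAbove_eq hl
    simp [ins]
  have h1 : (∀ l, l ≠ i → l ≠ j → ins (fun l => v (i.succAbove l)) l = s l) ↔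
      ∀ l, l ≠ i → l ≠ j → v l = s l :=
    forall₂_congr fun l h => by rw [hv l h]
  simp only [square, Function.comp, h1, hv j hij.symm, ite_self]

/-- Replacing the values of a cube on an edge. -/
theorem replace_edge_mem (hC : IsNilspace C) (hE : IsErgodic C k) {e x y z w : X}
    {i j : Fin (k + 1)} (hij : i ≠ j) (s : Cube (k + 1))
    (h : square e i j s x y z w ∈ C (k + 1)) {q q' : Cube (k + 1) → X} (hq : q ∈ C (k + 1))
    (hx : q s = x) (hy : q (Function.update s i (!s i)) = y)
    (hz : q' s = z) (hw : q' (Function.update s i (!s i)) = w)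
    (hqq : ∀ v, v ≠ s → v ≠ Function.update s i (!s i) → q' v = q v) : q' ∈ C (k + 1) := by
  classical
  have hbool : ∀ {a b : Bool}, a ≠ b → a = !b := by decide
  have hedge : ∀ v, (∀ l ∈ ({i}ᶜ : Set (Fin (k + 1))), v l = s l) →
      (v i = s i ∧ v = s) ∨ (v i ≠ s i ∧ v = Function.update s i (!s i)) := fun v hv => by
    by_cases hi : v i = s i
    · refine Or.inl ⟨hi, funext fun l => ?_⟩
      by_cases hl : l = i
      · rw [hl, hi]
      · exact hv l hl
    · refine Or.inr ⟨hi, funext fun l => ?_⟩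
      by_cases hl : l = i
      · subst hl; simpa using hbool hi
      · rw [Function.update_of_ne hl]; exact hv l hl
  -- `h₀` and `h₁` give two cubes that differ only on the edge through `s` in direction `i`; on the
  -- parallel edge both have values `x`, `y`.
  have h₀ : square e i j s x y x y ∈ C (k + 1) := by
    rw [square_swap]
    exact square_self_mem hC hE _ _ _ _ _ hij.symm _
  have h₁ : square e i j s z w x y ∈ C (k + 1) := by
    rw [square_symm e hij] at h
    exact square_mem_of_square_mem hC hij hij h
  have := (hC.isCubeOn_replace {i}ᶜ s (.of_mem hq) (.of_mem h₀) (.of_mem h₁) (fun v hv => ?_)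
    fun v hv => ?_).mem hC
  · convert this using 1
    funext v
    by_cases hv : ∀ l ∈ ({i}ᶜ : Set (Fin (k + 1))), v l = s l
    · have hj := hv j hij.symm
      have hv' : ∀ l, l ≠ i → l ≠ j → v l = s l := fun l hl _ => hv l hl
      rw [if_pos hv, square, if_pos hv', if_pos hj]
      rcases hedge v hv with ⟨hi, rfl⟩ | ⟨hi, h'⟩
      · rw [if_pos hi, hz]
      · rw [if_neg hi, h', hw]
    · rw [if_neg hv]
      refine hqq v (fun h' => hv fun l _ => by rw [h']) fun h' => hv fun l hl => ?_
      rw [h', Function.update_of_ne hl]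
  · by_cases hj : v j = s j
    · have : ¬∀ l, l ≠ i → l ≠ j → v l = s l := fun h' => hv fun l hl => by
        by_cases hlj : l = j
        · rw [hlj, hj]
        · exact h' l hl hlj
      simp only [square, if_neg this]
    · simp only [square, if_neg hj]
  · have hj := hv j hij.symm
    have hv' : ∀ l, l ≠ i → l ≠ j → v l = s l := fun l hl _ => hv l hl
    rw [square, if_pos hv', if_pos hj]
    rcases hedge v hv with ⟨hi, rfl⟩ | ⟨hi, h'⟩
    · rw [if_pos hi, hx]
    · rw [if_neg hi, h', hy]

/-- The abelian group underlying a `k`-fold ergodic `k`-step nilspace. -/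
theorem IsStepNilspace.exists_addCommGroup (hC : IsStepNilspace C k) (hE : IsErgodic C k)
    (e : X) {i j : Fin (k + 1)} (hij : i ≠ j) :
    ∃ _ : AddCommGroup X, (0 : X) = e ∧ ∀ x y z w,
      square e i j (vertexZero _) x y z w ∈ C (k + 1) ↔ x + w = y + z := by
  have hN := hC.toIsNilspace
  let t : Cube (k + 1) := Function.update (Function.update (vertexZero _) i true) j true
  have hti : t i = true := by simp [t, hij]
  have htj : t j = true := by simp [t]
  have htl : ∀ l, l ≠ i → l ≠ j → t l = false := fun l h1 h2 => by simp [t, h1, h2, vertexZero]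
  have hupd : ∀ x y z w w', Function.update (square e i j (vertexZero _) x y z w) t w' =
      square e i j (vertexZero _) x y z w' := fun x y z w w' => by
    funext v
    by_cases hv : v = t
    · subst hv
      simp +contextual [square, vertexZero, hti, htj, htl]
    · rw [Function.update_of_ne hv]
      have : ¬((∀ l, l ≠ i → l ≠ j → v l = false) ∧ v i = true ∧ v j = true) := fun ⟨h1, h2, h3⟩ =>
        hv (funext fun l => by
          by_cases hi : l = i
          · rw [hi, h2, hti]
          by_cases hj : l = j
          · rw [hj, h3, htj]
          rw [h1 l hi hj, htl l hi hj])
      simp only [square]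
      by_cases h1 : ∀ l, l ≠ i → l ≠ j → v l = vertexZero _ l
      · rw [if_pos h1, if_pos h1]
        cases h2 : v i <;> cases h3 : v j <;> simp [vertexZero]
        exact (this ⟨h1, h2, h3⟩).elim
      · rw [if_neg h1, if_neg h1]
  refine exists_addCommGroup_of_parallelogram _ e ?_ ?_ ?_ ?_ ?_ ?_
  · intro x y z
    obtain ⟨w, hw, -⟩ := hC.existsUnique_update hE (square e i j (vertexZero _) x y z e) t
    exact ⟨w, by rwa [hupd] at hw⟩
  · intro x y z w w' hw hw'
    refine (hC.existsUnique_update hE (square e i j (vertexZero _) x y z e) t).unique ?_ ?_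
    · rwa [hupd]
    · rwa [hupd]
  · intro x y z w h
    rw [square_swap] at h
    exact square_mem_of_square_mem hN hij.symm hij h
  · intro x y z w h
    rw [square_symm e hij] at h
    exact square_mem_of_square_mem hN hij hij h
  · intro x z
    exact square_self_mem hN hE _ _ _ _ _ hij _
  · intro x y z w u v h₁ h₂
    -- Reflection in direction `j` puts the edge `z`, `w` at the base vertex, where `h₂` lets it be
    -- replaced by `u`, `v`.
    rw [square_symm e hij] at h₁ ⊢
    generalize Function.update (vertexZero (k + 1)) j (!vertexZero (k + 1) j) = s at h₁ ⊢
    refine replace_edge_mem hN hE hij s (square_mem_of_square_mem hN hij hij h₂) h₁ ?_ ?_ ?_ ?_ ?_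
    · simp [square]
    · simp +contextual [square, hij.symm]
    · simp [square]
    · simp +contextual [square, hij.symm]
    · intro p h1 h2
      simp only [square]
      split_ifs with h3 h4 h5
      · exact absurd (funext fun l => by
          by_cases hi : l = i
          · rw [hi, h5]
          by_cases hj : l = j
          · rw [hj, h4]
          exact h3 l hi hj) h1
      · refine absurd (funext fun l => ?_) h2
        by_cases hi : l = i
        · subst hi
          rw [Function.update_self]
          have hbool : ∀ {a b : Bool}, a ≠ b → a = !b := by decide
          exact hbool h5
        rw [Function.update_of_ne hi]
        by_cases hj : l = j
        · rw [hj, h4]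
        exact h3 l hi hj
      all_goals rfl

/-- In a `k`-fold ergodic `k`-step nilspace with the associated group structure, the cubes of
dimension `k + 1` are the maps whose alternating sum vanishes. -/
theorem IsStepNilspace.mem_iff_altSum_eq_zero [AddCommGroup X] (hC : IsStepNilspace C k)
    (hE : IsErgodic C k) {i j : Fin (k + 1)} (hij : i ≠ j)
    (h : ∀ x y z w : X, square 0 i j (vertexZero _) x y z w ∈ C (k + 1) ↔ x + w = y + z)
    (q : Cube (k + 1) → X) : q ∈ C (k + 1) ↔ altSum q = 0 := by
  classical
  have hN := hC.toIsNilspace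
  have hmp : ∀ q ∈ C (k + 1), altSum q = 0 := by
    -- Values are cleared upwards by subtracting constants along edges. Once only `1^(k+1)` may be
    -- left, uniqueness makes the cube zero.
    have key := lowerSet_induction (α := Cube (k + 1)) (P := fun S => ∀ q ∈ C (k + 1),
      (∀ v ∈ S, q v = 0) → altSum q = 0) ?_ ?_ ∅ isLowerSet_empty
    · exact fun q hq => key q hq (by simp)
    · intro q _ hq
      have : q = 0 := funext fun v => hq v trivial
      rw [this, altSum_zero]
    · intro S hS s hs hlt ih q hq hqS
      by_cases hst : ∀ l, s l = true
      · have : q = 0 := hC.eq_of_mem hE s hq (hN.const_mem 0 _) fun v hv =>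
          hqS v (hlt v (lt_of_le_of_ne (fun l => by rw [hst l]; exact Bool.le_true _) hv))
        rw [this, altSum_zero]
      · push Not at hst
        obtain ⟨l, hl⟩ := hst
        obtain ⟨m, hm⟩ : ∃ m, l ≠ m := by
          by_cases hli : l = i
          · exact ⟨j, hli ▸ hij⟩
          · exact ⟨i, hli⟩
        let s' := Function.update s l (!s l)
        have hss' : s' ≠ s := fun h' => by
          have := congrFun h' l
          simp [s'] at this
        have hs' : s' ∉ S := fun h' => hs (hS (fun o => by
          by_cases ho : o = l
          · subst ho; simp [hl]
          · simp [s', ho]) h')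
        -- `c` is constant on the edge from `s` up to `s'`, so it does not depend on coordinate `l`
        -- and has alternating sum zero.
        let c : Cube (k + 1) → X := fun v => if v = s ∨ v = s' then q s else 0
        have hc : altSum c = 0 := altSum_eq_zero l fun v => by
          have : (Function.update v l (!v l) = s ∨ Function.update v l (!v l) = s') ↔
              (v = s ∨ v = s') := by
            have aux : ∀ u : Cube (k + 1), (u = s ∨ u = s') ↔ ∀ o, o ≠ l → u o = s o := by
              intro u
              constructor
              · rintro (rfl | rfl) o ho
                · rfl
                · simp [s', ho]
              · intro h'
                have hb : u l = s l ∨ u l = !s l := by cases u l <;> cases s l <;> simp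
                refine hb.imp (fun h'' => ?_) fun h'' => ?_ <;> funext o <;> by_cases ho : o = l
                · rw [ho, h'']
                · exact h' o ho
                · subst ho; simpa [s'] using h''
                · simpa [s', ho] using h' o ho
            rw [aux, aux]
            exact forall₂_congr fun o ho => by rw [Function.update_of_ne ho]
          simp only [c, this]
        have hq' : q + -c ∈ C (k + 1) := by
          refine replace_edge_mem hN hE hm s (e := 0) (x := q s) (y := q s') (z := 0)
            (w := q s' - q s) (square_mem_of_square_mem hN hij hm ((h _ _ _ _).2 (by abel)))
            hq rfl rfl (by simp [c]) ?_ ?_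
          · change q s' + -c s' = _
            simp [c, sub_eq_add_neg]
          · intro v h1 h2
            change v ≠ s' at h2
            simp [c, h1, h2]
        have := ih _ hq' (by
          rintro v (rfl | hv)
          · simp [c]
          · have h1 : v ≠ s := fun h' => hs (h' ▸ hv)
            have h2 : v ≠ s' := fun h' => hs' (h' ▸ hv)
            simp [c, h1, h2, hqS v hv])
        rwa [altSum_add, altSum_neg, hc, neg_zero, add_zero] at this
  refine ⟨hmp q, fun hq => ?_⟩
  -- Some cube agrees with `q` off `1^(k+1)`; the difference has one possibly non-zero value and
  -- zero alternating sum, so it vanishes.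
  obtain ⟨x, hx, -⟩ := hC.existsUnique_update hE q (vertexOne _)
  have hd : altSum (Function.update q (vertexOne _) x + -q) = 0 := by
    rw [altSum_add, altSum_neg, hmp _ hx, hq, neg_zero, add_zero]
  have := eq_zero_of_altSum_eq_zero (vertexOne _) (fun v hv => by simp [hv]) hd
  have hxq : x = q (vertexOne _) := by simpa [add_neg_eq_zero] using this
  rw [hxq, Function.update_eq_self] at hx
  exact hx

/-- A non-empty `k`-fold ergodic `k`-step nilspace is the degree-`k` structure of an abelian
group. -/
theorem IsStepNilspace.isomorphic_degreeStructure {X : Type u} {C : CubeStructure X}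
    (hC : IsStepNilspace C k) (hE : IsErgodic C k) [Nonempty X] :
    ∃ (Z : Type u) (_ : AddCommGroup Z), Isomorphic C (degreeStructure k Z) := by
  have e : X := Classical.arbitrary X
  suffices ∃ _ : AddCommGroup X, ∀ q : Cube (k + 1) → X, q ∈ C (k + 1) ↔ altSum q = 0 by
    obtain ⟨_, h⟩ := this
    have hCD : C = degreeStructure k X := by
      funext n
      ext q
      rw [hC.mem_iff, mem_degreeStructure_iff]
      simp only [h]
    refine ⟨X, inferInstance, Equiv.refl X, ?_, ?_⟩
    · rw [← hCD]; exact fun n q hq => hq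
    · rw [← hCD]; exact fun n q hq => hq
  rcases Nat.eq_zero_or_pos k with rfl | hk
  -- For `k = 0` there are no two directions to span a square. All maps on `{0,1}` are cubes, so
  -- uniqueness of completion leaves only one point.
  · have hsub : ∀ x y : X, x = y := fun x y => by
      have h1 := hC.ergodicity
      rw [IsErgodic] at h1
      have hne : vertexZero 1 ≠ vertexOne 1 := fun h => by
        simpa [vertexZero, vertexOne] using congrFun h 0
      have := hC.eq_of_mem hE (q := fun _ => x) (q' := fun v => if v = vertexZero 1 then x else y)
        (vertexOne 1) (hC.const_mem _ _) (by change _ ∈ C 1; rw [h1]; trivial) fun v hv => by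
          have : v = vertexZero 1 := funext fun i => by
            by_contra hi
            refine hv (funext fun i' => ?_)
            rw [Subsingleton.elim (α := Fin 1) i' i]
            simpa [vertexZero, vertexOne] using hi
          simp [this]
      simpa [hne.symm] using congrFun this (vertexOne 1)
    let _ : Unique X := ⟨⟨e⟩, fun _ => hsub _ _⟩
    refine ⟨(Equiv.ofUnique X PUnit.{1}).addCommGroup, fun q => ⟨fun _ => hsub _ _, fun _ => ?_⟩⟩
    rw [show q = fun _ => e from funext fun _ => hsub _ _]
    exact hC.const_mem _ _
  · have hij : (⟨0, by omega⟩ : Fin (k + 1)) ≠ ⟨1, by omega⟩ := by simp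
    obtain ⟨_, h0, h⟩ := hC.exists_addCommGroup hE e hij
    subst h0
    exact ⟨inferInstance, hC.mem_iff_altSum_eq_zero hE hij h⟩

end Ergodic

end Nilspace

theorem proposition3p2p1 {X : Type u} (C : Nilspace.CubeStructure X) (k : ℕ)
    (hC : Nilspace.IsStepNilspace C k) :
    (Nonempty X → Nilspace.IsErgodic C k →
      ∃ (Z : Type u) (_ : AddCommGroup Z),
        Nilspace.Isomorphic C (Nilspace.degreeStructure k Z)) ∧
    (1 ≤ k →
      Equivalence (Nilspace.Sim C (k - 1)) ∧
      ∀ x : X, ∃ (Z : Type u) (_ : AddCommGroup Z),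
        Nilspace.Isomorphic (Nilspace.restrict C (Nilspace.simClass C (k - 1) x))
          (Nilspace.degreeStructure k Z)) := by
  refine ⟨fun _ hE => hC.isomorphic_degreeStructure hE, fun hk => ?_⟩
  have hN := hC.toIsNilspace
  refine ⟨hN.equivalence_sim _, fun x => ?_⟩
  obtain ⟨j, rfl⟩ : ∃ j, k = j + 1 := ⟨k - 1, by omega⟩
  have : Nonempty (Nilspace.simClass C j x) := ⟨⟨x, (hN.equivalence_sim j).refl x⟩⟩
  exact (hC.restrict_simClass x).isomorphic_degreeStructure (hN.isErgodic_simClass j x)
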